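/- A partial Boolean function on $n$ bits is a function $g$ from a subset of $\{0,1\}^n$ to $\{0,1\}$; its $b$-inputs are the $s$ in its domain with $g(s)=b$. Suppose $g$ has at least one $0$-input and at least one $1$-input. The \emph{nonparity coefficient} $\mu(g)$ is the largest real $\mu^*$ for which there are probability distributions $D_0$ over the $0$-inputs of $g$ and $D_1$ over the $1$-inputs of $g$ such that for all $z\in\{0,1\}^n$, all $0$-inputs $\hat s_0$ and all $1$-inputs $\hat s_1$, $$\Pr_{s_0\sim D_0,\ s_1\sim D_1}\bigl[\,s_0\cdot z\equiv \hat s_1\cdot z \pmod 2\ \vee\ s_1\cdot z\equiv \hat s_0\cdot z \pmod 2\,\bigr]\ \ge\ \mu^*,$$ where $s_0$ and $s_1$ are drawn independently. \emph{Height-$h$ recursive Fourier sampling} $\mathrm{RFS}^g_h$ is the following partial Boolean function of a table of bits $A(x_1,\dots,x_h)$, $x_1,\dots,x_h\in\{0,1\}^n$. For $h=0$ the input is a single bit, which is also the answer. For $h\ge 1$ it is promised that for each $x_1$ the table $A(x_1,\cdot,\dots,\cdot)$ is an instance of $\mathrm{RFS}^g_{h-1}$, with answer bit $b(x_1)$,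 and that there is a secret string $s$ in the domain of $g$ (necessarily unique) with $b(x_1)\equiv s\cdot x_1 \pmod 2$ for all $x_1$; the answer is $g(s)$. Let $Q_2(f)$ be the bounded-error quantum query complexity of a partial Boolean function $f$: the least number $T$ of queries of a quantum algorithm $U_T O_A U_{T-1}\cdots O_A U_0$ (with unitaries independent of the input $A$, started in a fixed basis state, with any finite number of work qubits, and with query operator $O_A|i,b,w\rangle=|i,b\oplus A(i),w\rangle$) such that, on every input in the domain of $f$, measuring one designated qubit of the final state gives the value of $f$ with probability at least $2/3$. Theorem. $Q_2(\mathrm{RFS}^g_h)=\Omega\bigl((1-\mu(g))^{-h/2}\bigr)$; that is, there is an absolute constant $c>0$ such that for every $n$, every partial or total Boolean function $g$ on $n$ bits with at least one $0$-input and at least one $1$-input, and every $h\ge 0$, $$Q_2(\mathrm{RFS}^g_h)\ \ge\ c\,(1-\mu(g))^{-h/2}.$$ -/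

import Mathlib

namespace RFS

/-- A bit. Addition in `ZMod 2` is exclusive or. -/
abbrev Bit : Type := ZMod 2

/-- Bit strings of length `n`. The inner product modulo 2 of `s` and `z` is `s ⬝ᵥ z : Bit`. -/
abbrev Str (n : ℕ) : Type := Fin n → Bit

/-- A partial Boolean function on `n` bits; `g s = none` means that `g` is undefined at `s`.
Total functions are those that never take the value `none`. -/
abbrev PartialBool (n : ℕ) : Type := Str n → Option Bit

/-! ### Bounded-error quantum query complexity -/

section Query

variable {I : Type} [Fintype I] [DecidableEq I]

/-- Labels `(i, b, w, o)` of the computational basis: the query index `i`, the qubit `b` that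
receives the answer of a query, `m` further work qubits `w`, and the output qubit `o`. -/
abbrev BasisState (I : Type) (m : ℕ) : Type := I × Bit × (Fin m → Bit) × Bit

/-- The oracle for the input `A`: the linear extension of `|i, b, w, o⟩ ↦ |i, b ⊕ A i, w, o⟩`,
acting on vectors of amplitudes. -/
def oracle {m : ℕ} (A : I → Bit) (ψ : BasisState I m → ℂ) : BasisState I m → ℂ :=
  fun k => ψ (k.1, k.2.1 + A k.1, k.2.2)

/-- A quantum query algorithm with `m` additional work qubits: the number of queries it makes,
the basis state in which it starts, and the unitary operators that it applies
(only `U 0, …, U queries` are used). None of these depends on the input. -/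
structure QueryAlgorithm (I : Type) [Fintype I] [DecidableEq I] (m : ℕ) where
  queries : ℕ
  init : BasisState I m
  U : ℕ → Matrix.unitaryGroup (BasisState I m) ℂ

/-- The state `U_t O_A U_{t-1} O_A ⋯ O_A U_0 |init⟩` on input `A` after `t` queries. -/
def QueryAlgorithm.state {m : ℕ} (alg : QueryAlgorithm I m) (A : I → Bit) :
    ℕ → (BasisState I m → ℂ)
  | 0 => Matrix.mulVec (alg.U 0 : Matrix (BasisState I m) (BasisState I m) ℂ)
      (Pi.single alg.init 1)
  | t + 1 => Matrix.mulVec (alg.U (t + 1) : Matrix (BasisState I m) (BasisState I m) ℂ)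
      (oracle A (alg.state A t))

/-- The probability that measuring the output qubit at the end yields `b`. -/
noncomputable def QueryAlgorithm.outputProb {m : ℕ} (alg : QueryAlgorithm I m) (A : I → Bit)
    (b : Bit) : ℝ :=
  ∑ k : BasisState I m with k.2.2.2 = b, ‖alg.state A alg.queries k‖ ^ 2

/-- The algorithm computes the partial Boolean function `f` with error probability at most `1/3`
on every input in the domain of `f` (there is no requirement outside the domain). -/
def QueryAlgorithm.Computes {m : ℕ} (alg : QueryAlgorithm I m)
    (f : (I → Bit) → Option Bit) : Prop :=
  ∀ (A : I → Bit) (b : Bit), f A = some b → 2 / 3 ≤ alg.outputProb A b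

/-- The bounded-error quantum query complexity of a partial Boolean function `f`: the least number
of queries of a quantum algorithm, with any number of work qubits, that computes `f` with error
probability at most `1/3`. -/
noncomputable def Q₂ (f : (I → Bit) → Option Bit) : ℕ∞ :=
  ⨅ (m : ℕ) (alg : QueryAlgorithm I m) (_ : alg.Computes f), (alg.queries : ℕ∞)

end Query

/-! ### Recursive Fourier sampling -/

/-- The partial Boolean function height-`h` recursive Fourier sampling with `g` at every vertex.
Its input is the table of bits `A (x₁, …, x_h)`.
At height `0` the input is a single bit, which is the answer.
At height `h + 1` the promise is that for every `x₁` the restriction of `A` is an instance at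
height `h`, with answer bit `b x₁`, and that `b x₁ = s ⬝ᵥ x₁` for a secret string `s`, at which
`g` is defined; the answer is `g s`. The string `s` is unique, see `rfs_succ_eq_some_iff`. -/
noncomputable def rfs {n : ℕ} (g : PartialBool n) :
    (h : ℕ) → ((Fin h → Str n) → Bit) → Option Bit
  | 0, A => some (A Fin.elim0)
  | h + 1, A =>
    open scoped Classical in
    if hs : ∃ s : Str n, ∀ x : Str n,
        rfs g h (fun y => A (Fin.cons x y : Fin (h + 1) → Str n)) = some (s ⬝ᵥ x) then
      g hs.choose
    else none

theorem rfs_succ_eq_some_iff {n : ℕ} (g : PartialBool n) (h : ℕ)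
    (A : (Fin (h + 1) → Str n) → Bit) (b : Bit) :
    rfs g (h + 1) A = some b ↔
      ∃ s : Str n, (∀ x : Str n,
        rfs g h (fun y => A (Fin.cons x y : Fin (h + 1) → Str n)) = some (s ⬝ᵥ x)) ∧
        g s = some b := by
  rw [rfs]
  constructor
  · intro H
    split_ifs at H with hs
    exact ⟨hs.choose, hs.choose_spec, H⟩
  · rintro ⟨s, hs, hb⟩
    have hex : ∃ s : Str n, ∀ x : Str n,
        rfs g h (fun y => A (Fin.cons x y : Fin (h + 1) → Str n)) = some (s ⬝ᵥ x) := ⟨s, hs⟩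
    rw [dif_pos hex]
    have : hex.choose = s := by
      apply dotProduct_eq
      intro x
      exact Option.some_injective _ ((hex.choose_spec x).symm.trans (hs x))
    rw [this, hb]

/-! ### The nonparity coefficient -/

/-- `D` is (the mass function of) a probability distribution over the `b`-inputs of `g`. -/
def IsDistOver {n : ℕ} (g : PartialBool n) (b : Bit) (D : Str n → ℝ) : Prop :=
  D ∈ stdSimplex ℝ (Str n) ∧ ∀ s, D s ≠ 0 → g s = some b

/-- The probability, for independent `s₀` drawn from `D₀` and `s₁` drawn from `D₁`, that
`s₀ · z ≡ t₁ · z` or `s₁ · z ≡ t₀ · z` modulo 2. -/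
noncomputable def agreeProb {n : ℕ} (D₀ D₁ : Str n → ℝ) (z t₀ t₁ : Str n) : ℝ :=
  ∑ s₀ : Str n, ∑ s₁ : Str n,
    if s₀ ⬝ᵥ z = t₁ ⬝ᵥ z ∨ s₁ ⬝ᵥ z = t₀ ⬝ᵥ z then D₀ s₀ * D₁ s₁ else 0

/-- The nonparity coefficient: the largest `r` for which there are distributions `D₀` over the
`0`-inputs and `D₁` over the `1`-inputs of `g` such that, for every `z`, every `0`-input `t₀` and
every `1`-input `t₁`, the probability above is at least `r`. (When `g` takes both values, this set
of reals contains `0` and is bounded above by `1`.) -/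
noncomputable def nonparityCoeff {n : ℕ} (g : PartialBool n) : ℝ :=
  sSup {r : ℝ | ∃ D₀ D₁ : Str n → ℝ, IsDistOver g 0 D₀ ∧ IsDistOver g 1 D₁ ∧
    ∀ z t₀ t₁ : Str n, g t₀ = some 0 → g t₁ = some 1 → r ≤ agreeProb D₀ D₁ z t₀ t₁}

end RFS

/-! The argument is a weighted quantum adversary bound, with a weight that behaves multiplicatively
under recursion.

For a coupling of `0`-inputs and `1`-inputs, the average inner product of the two final states
starts at 1 and must fall to at most 17/18. If, for every coupled pair and every index where its
members differ, the two conditional probabilities of a difference there have product at most `v ^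
2`, one query lowers this average by at most `2 * v` (`QueryAlgorithm.Computes.adversary_bound`).

For recursive Fourier sampling, draw the secrets `s` and `t` independently from `D 0` and `D 1`.
Children `x` with `s ⬝ᵥ x = t ⬝ᵥ x` receive identical subtables, and the other children are coupled
recursively; hence the induction must carry diagonal couplings as well. A difference at an index
below the child `z` requires `s ⬝ᵥ z ≠ t ⬝ᵥ z` and a difference in the subtables. Conditioned on
either table, these requirements contribute separate factors. The product of the two secret factors
is the complement of the probability in the nonparity coefficient (`agreeProb_add_mul`), so each
level multiplies the bound by about `1 - nonparityCoeff g` (`flipMass_mul_composeJoint_le`). The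
adversary bound takes a square root, whence the exponent `-h / 2`. -/

namespace RFS

open Finset

/-! ### The weighted adversary bound -/

section Adversary

variable {I : Type} {m : ℕ}

/-- The real part of the inner product of two vectors of amplitudes. -/
noncomputable def reInner {κ : Type} [Fintype κ] (a b : κ → ℂ) : ℝ :=
  (star a ⬝ᵥ b).re

theorem reInner_eq_sum {κ : Type} [Fintype κ] (a b : κ → ℂ) :
    reInner a b = ∑ k, (star (a k) * b k).re := by
  simp [reInner, dotProduct]

theorem reInner_self {κ : Type} [Fintype κ] (a : κ → ℂ) : reInner a a = ∑ k, ‖a k‖ ^ 2 := by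
  rw [reInner_eq_sum]
  refine sum_congr rfl fun k _ => ?_
  rw [← Complex.normSq_eq_norm_sq, Complex.normSq_apply]
  simp

theorem reInner_mulVec {κ : Type} [Fintype κ] [DecidableEq κ] (U : Matrix.unitaryGroup κ ℂ)
    (a b : κ → ℂ) :
    reInner ((U : Matrix κ κ ℂ).mulVec a) ((U : Matrix κ κ ℂ).mulVec b) = reInner a b := by
  have hU : (U : Matrix κ κ ℂ).conjTranspose * (U : Matrix κ κ ℂ) = 1 :=
    Matrix.mem_unitaryGroup_iff'.1 U.2
  rw [reInner, reInner, Matrix.star_mulVec, Matrix.dotProduct_mulVec, Matrix.vecMul_vecMul, hU,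
    Matrix.vecMul_one]

/-- AM-GM with a free weight `l`, which later balances the different flip probabilities of the two
inputs. -/
theorem abs_re_star_mul_le (x y : ℂ) {l : ℝ} (hl : 0 < l) :
    |(star x * y).re| ≤ (l * ‖x‖ ^ 2 + ‖y‖ ^ 2 / l) / 2 := by
  have h1 : |(star x * y).re| ≤ ‖x‖ * ‖y‖ := by
    simpa using Complex.abs_re_le_norm (star x * y)
  have h2 : l * ‖x‖ ^ 2 + ‖y‖ ^ 2 / l - 2 * (‖x‖ * ‖y‖) = (l * ‖x‖ - ‖y‖) ^ 2 / l := by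
    field_simp
    ring
  have h3 : 0 ≤ (l * ‖x‖ - ‖y‖) ^ 2 / l := by positivity
  linarith

/-- The probability that measuring the query register of `ψ` yields `i`. -/
noncomputable def queryMass (ψ : BasisState I m → ℂ) (i : I) : ℝ :=
  ∑ k : Bit × (Fin m → Bit) × Bit, ‖ψ (i, k)‖ ^ 2

theorem queryMass_nonneg (ψ : BasisState I m → ℂ) (i : I) : 0 ≤ queryMass ψ i :=
  sum_nonneg fun _ _ => by positivity

variable [Fintype I]

theorem sum_queryMass (ψ : BasisState I m → ℂ) : ∑ i, queryMass ψ i = reInner ψ ψ := by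
  rw [reInner_self, Fintype.sum_prod_type]
  rfl

theorem sum_shift_bit {W : Type} [Fintype W] (c : Bit) (F : Bit × W → ℝ) :
    ∑ k : Bit × W, F (k.1 + c, k.2) = ∑ k, F k := by
  rw [Fintype.sum_prod_type, Fintype.sum_prod_type]
  exact Equiv.sum_comp (Equiv.addRight c) fun b => ∑ w, F (b, w)

/-- A query changes the inner product only through the indices where the two inputs differ. -/
theorem reInner_oracle_ge (A B : I → Bit) (a b : BasisState I m → ℂ) (l : I → ℝ)
    (hl : ∀ i, A i ≠ B i → 0 < l i) :
    reInner a b - ∑ i, (if A i ≠ B i then l i * queryMass a i + queryMass b i / l i else 0) ≤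
      reInner (oracle A a) (oracle B b) := by
  rw [reInner_eq_sum, reInner_eq_sum, Fintype.sum_prod_type, Fintype.sum_prod_type,
    ← sum_sub_distrib]
  refine sum_le_sum fun i _ => ?_
  simp only [oracle]
  split_ifs with h
  -- Index `i` contributes at most half the subtracted term in absolute value, both before and after
  -- the query, since shifting the answer bit preserves the query mass.
  · have hi := hl i h
    have h1 : ∑ k : Bit × (Fin m → Bit) × Bit, (star (a (i, k)) * b (i, k)).re ≤
        (l i * queryMass a i + queryMass b i / l i) / 2 := by
      rw [queryMass, queryMass, mul_sum, sum_div, ← sum_add_distrib, sum_div]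
      exact sum_le_sum fun k _ => (le_abs_self _).trans (abs_re_star_mul_le _ _ hi)
    have h2 : -((l i * queryMass a i + queryMass b i / l i) / 2) ≤
        ∑ k : Bit × (Fin m → Bit) × Bit,
          (star (a (i, k.1 + A i, k.2)) * b (i, k.1 + B i, k.2)).re := by
      rw [queryMass, queryMass, ← sum_shift_bit (A i) fun k => ‖a (i, k)‖ ^ 2,
        ← sum_shift_bit (B i) fun k => ‖b (i, k)‖ ^ 2, mul_sum, sum_div, ← sum_add_distrib,
        sum_div, ← sum_neg_distrib]
      exact sum_le_sum fun k _ => neg_le_of_abs_le (abs_re_star_mul_le _ _ hi)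
    linarith
  · rw [not_not] at h
    rw [h, sub_zero, sum_shift_bit (B i) fun k => (star (a (i, k)) * b (i, k)).re]

theorem reInner_oracle_self (A : I → Bit) (a : BasisState I m → ℂ) :
    reInner (oracle A a) (oracle A a) = reInner a a := by
  rw [reInner_self, reInner_self, Fintype.sum_prod_type, Fintype.sum_prod_type]
  exact sum_congr rfl fun i _ => sum_shift_bit (A i) fun k => ‖a (i, k)‖ ^ 2

variable [DecidableEq I]

theorem reInner_init (k : BasisState I m) :
    reInner (Pi.single k 1 : BasisState I m → ℂ) (Pi.single k 1) = 1 := by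
  simp [reInner]

theorem QueryAlgorithm.reInner_state_self (alg : QueryAlgorithm I m) (A : I → Bit) (t : ℕ) :
    reInner (alg.state A t) (alg.state A t) = 1 := by
  induction t with
  | zero => rw [state, reInner_mulVec, reInner_init]
  | succ t ih => rw [state, reInner_mulVec, reInner_oracle_self, ih]

theorem QueryAlgorithm.outputProb_add (alg : QueryAlgorithm I m) (A : I → Bit) :
    alg.outputProb A 0 + alg.outputProb A 1 = 1 := by
  rw [← alg.reInner_state_self A alg.queries, reInner_self, outputProb, outputProb,
    ← sum_filter_add_sum_filter_not univ (fun k : BasisState I m => k.2.2.2 = 0)]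
  congr 2
  ext k
  have : ∀ b : Bit, b = 1 ↔ ¬ b = 0 := by decide
  simp [this]

/-- States from which different answers are obtained are far from parallel. -/
theorem QueryAlgorithm.reInner_final_le (alg : QueryAlgorithm I m) (A B : I → Bit)
    (hA : 2 / 3 ≤ alg.outputProb A 0) (hB : 2 / 3 ≤ alg.outputProb B 1) :
    reInner (alg.state A alg.queries) (alg.state B alg.queries) ≤ 17 / 18 := by
  have h01 : ∀ b : Bit, ¬ b = 0 ↔ b = 1 := by decide
  have key : ∀ (b : Bit) (l : ℝ), 0 < l →
      ∑ k : BasisState I m with k.2.2.2 = b,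
        (star (alg.state A alg.queries k) * alg.state B alg.queries k).re ≤
      (l * alg.outputProb A b + alg.outputProb B b / l) / 2 := by
    intro b l hl
    rw [outputProb, outputProb, mul_sum, sum_div, ← sum_add_distrib, sum_div]
    exact sum_le_sum fun k _ => (le_abs_self _).trans (abs_re_star_mul_le _ _ hl)
  -- The optimal weights are `√(1/2)` and `√2`, giving `2√2/3`; these rational approximations give
  -- 17/18.
  have h0 := key 0 (2 / 3) (by norm_num)
  have h1 := key 1 (3 / 2) (by norm_num)
  have hA' := alg.outputProb_add A
  have hB' := alg.outputProb_add B
  rw [reInner_eq_sum, ← sum_filter_add_sum_filter_not univ (fun k : BasisState I m => k.2.2.2 = 0)]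
  simp only [h01]
  linarith

/-- The weight that `R` gives to pairs of `A` with an input that differs from `A` at `i`. -/
noncomputable def flipMass (R : (I → Bit) → (I → Bit) → ℝ) (A : I → Bit) (i : I) : ℝ :=
  ∑ B, if A i ≠ B i then R A B else 0

theorem flipMass_nonneg {R : (I → Bit) → (I → Bit) → ℝ} (hR : ∀ A B, 0 ≤ R A B) (A : I → Bit)
    (i : I) : 0 ≤ flipMass R A i :=
  sum_nonneg fun B _ => by split_ifs <;> simp [hR]

theorem flipMass_le_sum {R : (I → Bit) → (I → Bit) → ℝ} (hR : ∀ A B, 0 ≤ R A B) (A : I → Bit)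
    (i : I) : flipMass R A i ≤ ∑ B, R A B :=
  sum_le_sum fun B _ => by split_ifs <;> simp [hR]

theorem flipMass_pos {R : (I → Bit) → (I → Bit) → ℝ} (hR : ∀ A B, 0 ≤ R A B) {A B : I → Bit}
    {i : I} (h : R A B ≠ 0) (hi : A i ≠ B i) : 0 < flipMass R A i := by
  refine lt_of_lt_of_le ?_ (single_le_sum (f := fun B => if A i ≠ B i then R A B else 0)
    (fun B _ => ?_) (mem_univ B))
  · simpa [hi] using lt_of_le_of_ne (hR A B) h.symm
  · split_ifs <;> simp [hR]

/-- Summing over `B` turns `R A B` into `flipMass R A i`, which cancels the denominator; the query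
masses of a unit state then sum to 1. -/
theorem sum_flip_weight_le {R : (I → Bit) → (I → Bit) → ℝ} {p : (I → Bit) → ℝ}
    (hp : ∀ A, 0 ≤ p A) (ψ : (I → Bit) → BasisState I m → ℂ) (hψ : ∀ A, reInner (ψ A) (ψ A) = 1) :
    ∑ A, ∑ B, ∑ i, (if A i ≠ B i then R A B * (p A / flipMass R A i * queryMass (ψ A) i) else 0) ≤
      ∑ A, p A := by
  refine sum_le_sum fun A _ => ?_
  rw [sum_comm]
  calc _ = ∑ i, flipMass R A i * (p A / flipMass R A i * queryMass (ψ A) i) := by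
        refine sum_congr rfl fun i _ => ?_
        rw [flipMass, sum_mul]
        refine sum_congr rfl fun B _ => ?_
        split_ifs <;> simp
    _ ≤ ∑ i, p A * queryMass (ψ A) i := by
        refine sum_le_sum fun i _ => ?_
        by_cases h : flipMass R A i = 0
        · rw [h, zero_mul]
          exact mul_nonneg (hp A) (queryMass_nonneg _ _)
        · rw [← mul_assoc, mul_div_cancel₀ _ h]
    _ = p A := by rw [← mul_sum, sum_queryMass, hψ, mul_one]

/-- The weighted adversary bound: `R` is a probability distribution over pairs of a `0`-input and
a `1`-input, with marginals `p` and `q`. -/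
theorem QueryAlgorithm.Computes.adversary_bound {f : (I → Bit) → Option Bit}
    {alg : QueryAlgorithm I m} (hf : alg.Computes f)
    {R : (I → Bit) → (I → Bit) → ℝ} {p q : (I → Bit) → ℝ} {v : ℝ} (hv : 0 < v)
    (hR : ∀ A B, 0 ≤ R A B) (hp : ∀ A, ∑ B, R A B = p A) (hq : ∀ B, ∑ A, R A B = q B)
    (hsum : ∑ A, p A = 1) (hf₀ : ∀ A, p A ≠ 0 → f A = some 0) (hf₁ : ∀ B, q B ≠ 0 → f B = some 1)
    (hcond : ∀ A B i, R A B ≠ 0 → A i ≠ B i →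
      flipMass R A i * flipMass (fun B A => R A B) B i ≤ v ^ 2 * (p A * q B)) :
    1 / 36 ≤ alg.queries * v := by
  have hp0 : ∀ A, 0 ≤ p A := fun A => hp A ▸ sum_nonneg fun B _ => hR A B
  have hq0 : ∀ B, 0 ≤ q B := fun B => hq B ▸ sum_nonneg fun A _ => hR A B
  have hRp : ∀ A B, R A B ≤ p A := fun A B =>
    hp A ▸ single_le_sum (f := R A) (fun B _ => hR A B) (mem_univ B)
  have hRq : ∀ A B, R A B ≤ q B := fun A B =>
    hq B ▸ single_le_sum (f := fun A => R A B) (fun A _ => hR A B) (mem_univ A)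
  have hRsum : ∑ A, ∑ B, R A B = 1 := by simp_rw [hp, hsum]
  have hqsum : ∑ B, q B = 1 := by
    rw [← hRsum, sum_comm]
    simp_rw [hq]
  -- The progress measure: the average inner product of coupled states after `t` queries.
  set W : ℕ → ℝ := fun t => ∑ A, ∑ B, R A B * reInner (alg.state A t) (alg.state B t) with hW
  have hW0 : W 0 = 1 := by
    simp only [hW, state, reInner_mulVec, reInner_init, mul_one, hRsum]
  have hWT : W alg.queries ≤ 17 / 18 := by
    calc W alg.queries ≤ ∑ A, ∑ B, R A B * (17 / 18) := by
          refine sum_le_sum fun A _ => sum_le_sum fun B _ => ?_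
          by_cases h : R A B = 0
          · simp [h]
          have hpos : 0 < R A B := lt_of_le_of_ne (hR A B) (Ne.symm h)
          exact mul_le_mul_of_nonneg_left (alg.reInner_final_le A B
            (hf A 0 (hf₀ A (hpos.trans_le (hRp A B)).ne'))
            (hf B 1 (hf₁ B (hpos.trans_le (hRq A B)).ne'))) (hR A B)
      _ = 17 / 18 := by simp_rw [← sum_mul, hRsum, one_mul]
  have hstep : ∀ t, W t - 2 * v ≤ W (t + 1) := by
    intro t
    have hpt : ∀ A B, R A B * reInner (alg.state A t) (alg.state B t) -
        v * (∑ i, (if A i ≠ B i then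
            R A B * (p A / flipMass R A i * queryMass (alg.state A t) i) else 0) +
          ∑ i, (if A i ≠ B i then
            R A B * (q B / flipMass (fun B A => R A B) B i * queryMass (alg.state B t) i) else 0)) ≤
        R A B * reInner (alg.state A (t + 1)) (alg.state B (t + 1)) := by
      intro A B
      by_cases h : R A B = 0
      · simp [h]
      have hpos : 0 < R A B := lt_of_le_of_ne (hR A B) (Ne.symm h)
      have hpA := hpos.trans_le (hRp A B)
      have hqB := hpos.trans_le (hRq A B)
      have hθA : ∀ i, A i ≠ B i → 0 < flipMass R A i := fun i hi => flipMass_pos hR h hi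
      have hθB : ∀ i, A i ≠ B i → 0 < flipMass (fun B A => R A B) B i := fun i hi =>
        flipMass_pos (R := fun B A => R A B) (fun B A => hR A B) h hi.symm
      -- With this weight the `A` terms have the form summed in `sum_flip_weight_le`; `hcond` says
      -- precisely that its reciprocal is at most the analogous weight for `B`.
      have := reInner_oracle_ge A B (alg.state A t) (alg.state B t)
        (fun i => v * (p A / flipMass R A i))
        (fun i hi => mul_pos hv (div_pos hpA (hθA i hi)))
      have h2 := mul_le_mul_of_nonneg_left this (hR A B)
      rw [state, state, reInner_mulVec]
      refine le_trans ?_ h2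
      rw [mul_sub, ← sum_add_distrib, mul_sum, mul_sum]
      refine sub_le_sub_left (sum_le_sum fun i _ => ?_) _
      split_ifs with hi
      · have hA := hθA i hi
        have hB := hθB i hi
        have hc := hcond A B i h hi
        have h3 : 1 / (v * (p A / flipMass R A i)) ≤ v * (q B / flipMass (fun B A => R A B) B i) := by
          rw [div_le_iff₀ (by positivity), mul_mul_mul_comm, div_mul_div_comm, ← mul_div_assoc,
            le_div_iff₀ (by positivity)]
          linarith
        have h4 := mul_le_mul_of_nonneg_left h3 (queryMass_nonneg (alg.state B t) i)
        have h5 := mul_le_mul_of_nonneg_left h4 (hR A B)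
        rw [mul_one_div] at h5
        linarith
      · simp
    have h1 := sum_le_sum fun A (_ : A ∈ univ) => sum_le_sum fun B (_ : B ∈ univ) => hpt A B
    simp only [sum_sub_distrib, mul_add, sum_add_distrib, ← mul_sum] at h1
    have h2 := sum_flip_weight_le (R := R) hp0 (fun A => alg.state A t)
      fun A => alg.reInner_state_self A t
    have h3 : ∑ A, ∑ B, ∑ i, (if A i ≠ B i then
        R A B * (q B / flipMass (fun B A => R A B) B i * queryMass (alg.state B t) i) else 0) ≤
        ∑ B, q B := by
      refine le_trans (le_of_eq ?_) (sum_flip_weight_le (R := fun B A => R A B) hq0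
        (fun A => alg.state A t) fun A => alg.reInner_state_self A t)
      rw [sum_comm]
      exact sum_congr rfl fun A _ => sum_congr rfl fun B _ => sum_congr rfl fun i _ =>
        if_congr ne_comm rfl rfl
    rw [hsum] at h2
    rw [hqsum] at h3
    have h4 := mul_le_mul_of_nonneg_left h2 hv.le
    have h5 := mul_le_mul_of_nonneg_left h3 hv.le
    simp only [hW]
    linarith
  have hall : ∀ t, W 0 - t * (2 * v) ≤ W t := by
    intro t
    induction t with
    | zero => simp
    | succ t ih =>
      have := hstep t
      push_cast
      linarith
  -- A total loss of at least 1/18, at most `2 * v` per query, gives 1/36.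
  have := hall alg.queries
  linarith

end Adversary

/-! ### Weighted adversaries for recursive Fourier sampling -/

/-- A weighted adversary for `f`: a distribution `marg b` over the `b`-inputs of `f`, for each bit
`b`, and couplings `joint b c` of these distributions, the diagonal one when `b = c`. In the
coupling of `0`-inputs and `1`-inputs, conditioned on either input, it is unlikely that the other
one differs from it at a given index; `v` bounds the product of the two probabilities. -/
structure WeightedAdversary {I : Type} [Fintype I] [DecidableEq I] (f : (I → Bit) → Option Bit)
    (v : ℝ) where
  marg : Bit → (I → Bit) → ℝ
  joint : Bit → Bit → (I → Bit) → (I → Bit) → ℝ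
  joint_nonneg : ∀ c d A B, 0 ≤ joint c d A B
  joint_comm : ∀ c d A B, joint c d A B = joint d c B A
  sum_joint : ∀ c d A, ∑ B, joint c d A B = marg c A
  sum_marg : ∀ c, ∑ A, marg c A = 1
  eq_of_joint_ne_zero : ∀ c A B, joint c c A B ≠ 0 → A = B
  eq_some_of_marg_ne_zero : ∀ c A, marg c A ≠ 0 → f A = some c
  flipMass_mul_le : ∀ c d A B i, joint c d A B ≠ 0 → A i ≠ B i →
    flipMass (joint c d) A i * flipMass (joint d c) B i ≤ v * (marg c A * marg d B)

namespace WeightedAdversary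

section

variable {I : Type} [Fintype I] [DecidableEq I] {f : (I → Bit) → Option Bit} {v : ℝ}

theorem marg_nonneg (K : WeightedAdversary f v) (c : Bit) (A : I → Bit) : 0 ≤ K.marg c A :=
  K.sum_joint c 0 A ▸ sum_nonneg fun B _ => K.joint_nonneg c 0 A B

theorem joint_le_marg (K : WeightedAdversary f v) (c d : Bit) (A B : I → Bit) : K.joint c d A B ≤ K.marg c A :=
  K.sum_joint c d A ▸
    single_le_sum (f := K.joint c d A) (fun B _ => K.joint_nonneg c d A B) (mem_univ B)

theorem marg_ne_zero (K : WeightedAdversary f v) {c d : Bit} {A B : I → Bit} (h : K.joint c d A B ≠ 0) : K.marg c A ≠ 0 :=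
  ((lt_of_le_of_ne (K.joint_nonneg c d A B) h.symm).trans_le (K.joint_le_marg c d A B)).ne'

theorem flipMass_le_marg (K : WeightedAdversary f v) (c d : Bit) (A : I → Bit) (i : I) :
    flipMass (K.joint c d) A i ≤ K.marg c A :=
  K.sum_joint c d A ▸ flipMass_le_sum (K.joint_nonneg c d) A i

theorem flipMass_self (K : WeightedAdversary f v) (c : Bit) (A : I → Bit) (i : I) : flipMass (K.joint c c) A i = 0 := by
  refine sum_eq_zero fun B _ => ?_
  split_ifs with h
  · by_contra hne
    exact h (congrFun (K.eq_of_joint_ne_zero c A B hne) i)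
  · rfl

/-- The adversary bound on the number of queries. -/
theorem le_queries_mul (K : WeightedAdversary f v) {m : ℕ} {alg : QueryAlgorithm I m} (halg : alg.Computes f) {w : ℝ}
    (hw : 0 < w) (hvw : v ≤ w ^ 2) : 1 / 36 ≤ alg.queries * w := by
  refine halg.adversary_bound (R := K.joint 0 1) (p := K.marg 0) (q := K.marg 1) hw
    (K.joint_nonneg 0 1) (K.sum_joint 0 1) (fun B => ?_) (K.sum_marg 0)
    (K.eq_some_of_marg_ne_zero 0) (K.eq_some_of_marg_ne_zero 1) fun A B i h hi => ?_
  · simp_rw [K.joint_comm 0 1, K.sum_joint]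
  · have h1 := K.flipMass_mul_le 0 1 A B i h hi
    have h2 : (fun B A => K.joint 0 1 A B) = K.joint 1 0 := by
      ext B A
      exact K.joint_comm 0 1 A B
    rw [h2]
    exact h1.trans (mul_le_mul_of_nonneg_right hvw
      (mul_nonneg (K.marg_nonneg _ _) (K.marg_nonneg _ _)))

end

end WeightedAdversary

/-! #### Tables and their restrictions -/

/-- Inputs of recursive Fourier sampling of height `h`. -/
abbrev Table (n h : ℕ) : Type := (Fin h → Str n) → Bit

/-- The instance of height `h` at the child `x` of the root. -/
def Table.child {n h : ℕ} (A : Table n (h + 1)) (x : Str n) : Table n h :=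
  fun y => A (Fin.cons x y : Fin (h + 1) → Str n)

/-- A table of height `h + 1` is a family of tables of height `h`. -/
def Table.childEquiv (n h : ℕ) : Table n (h + 1) ≃ (Str n → Table n h) where
  toFun := Table.child
  invFun F z := F (z 0) (Fin.tail z)
  left_inv A := by
    ext z
    simp [Table.child]
  right_inv F := by
    ext x y
    simp [Table.child]

theorem Table.apply_eq_child {n h : ℕ} (A : Table n (h + 1)) (z : Fin (h + 1) → Str n) :
    A z = A.child (z 0) (Fin.tail z) := by
  simp [Table.child]

theorem sum_prod_child {n h : ℕ} (F : Str n → Table n h → ℝ) :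
    ∑ A : Table n (h + 1), ∏ x, F x (A.child x) = ∏ x, ∑ a, F x a := by
  rw [prod_univ_sum, Fintype.piFinset_univ]
  exact Equiv.sum_comp (Table.childEquiv n h) fun p => ∏ x, F x (p x)

/-! #### Composition -/

/-- The coupling of the distributions `D c` and `D d`: independent if `c ≠ d`, diagonal if
`c = d`. -/
noncomputable def secretJoint {n : ℕ} (D : Bit → Str n → ℝ) (c d : Bit) (s t : Str n) : ℝ :=
  if c = d then if s = t then D c s else 0 else D c s * D d t

/-! ### Couplings of the secret strings. -/

section Secret

variable {n : ℕ} {D : Bit → Str n → ℝ}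

theorem secretJoint_nonneg (hD : ∀ c s, 0 ≤ D c s) (c d : Bit) (s t : Str n) :
    0 ≤ secretJoint D c d s t := by
  unfold secretJoint
  split_ifs
  · exact hD _ _
  · exact le_rfl
  · exact mul_nonneg (hD _ _) (hD _ _)

theorem secretJoint_comm (c d : Bit) (s t : Str n) :
    secretJoint D c d s t = secretJoint D d c t s := by
  unfold secretJoint
  by_cases h : c = d
  · subst h
    by_cases hst : s = t
    · subst hst
      rfl
    · simp [hst, Ne.symm hst]
  · simp [h, Ne.symm h, mul_comm]

theorem sum_secretJoint (hD1 : ∀ c, ∑ s, D c s = 1) (c d : Bit) (s : Str n) :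
    ∑ t, secretJoint D c d s t = D c s := by
  unfold secretJoint
  split_ifs
  · simp
  · rw [← mul_sum, hD1, mul_one]

end Secret

/-- The distribution over tables of height `h + 1` given by a distribution over secret strings and
distributions over tables of height `h`. -/
noncomputable def composeMarg {n h : ℕ} (D : Bit → Str n → ℝ) (p : Bit → Table n h → ℝ) (c : Bit)
    (A : Table n (h + 1)) : ℝ :=
  ∑ s, D c s * ∏ x, p (s ⬝ᵥ x) (A.child x)

/-- The coupling of distributions over tables of height `h + 1` given by couplings of distributions
over secret strings and over tables of height `h`. -/
noncomputable def composeJoint {n h : ℕ} (D : Bit → Str n → ℝ)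
    (K : Bit → Bit → Table n h → Table n h → ℝ) (c d : Bit) (A B : Table n (h + 1)) : ℝ :=
  ∑ s, ∑ t, secretJoint D c d s t * ∏ x, K (s ⬝ᵥ x) (t ⬝ᵥ x) (A.child x) (B.child x)

/-! ### Marginals and flip masses of the composed coupling. -/

section Compose

variable {n h : ℕ} {g : PartialBool n} {v : ℝ} {D : Bit → Str n → ℝ}
  (K : WeightedAdversary (rfs g h) v)

theorem exists_of_composeJoint_ne_zero {c d : Bit} {A B : Table n (h + 1)}
    (hne : composeJoint D K.joint c d A B ≠ 0) :
    ∃ s t, secretJoint D c d s t ≠ 0 ∧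
      ∀ x, K.joint (s ⬝ᵥ x) (t ⬝ᵥ x) (A.child x) (B.child x) ≠ 0 := by
  obtain ⟨s, -, hs⟩ := exists_ne_zero_of_sum_ne_zero hne
  obtain ⟨t, -, ht⟩ := exists_ne_zero_of_sum_ne_zero hs
  exact ⟨s, t, left_ne_zero_of_mul ht, fun x =>
    prod_ne_zero_iff.1 (right_ne_zero_of_mul ht) x (mem_univ x)⟩

theorem sum_composeJoint (hD1 : ∀ c, ∑ s, D c s = 1) (c d : Bit) (A : Table n (h + 1)) :
    ∑ B, composeJoint D K.joint c d A B = composeMarg D K.marg c A := by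
  simp only [composeJoint, composeMarg]
  rw [sum_comm]
  refine sum_congr rfl fun s _ => ?_
  rw [sum_comm, ← sum_secretJoint hD1 c d s, sum_mul]
  refine sum_congr rfl fun t _ => ?_
  rw [← mul_sum, sum_prod_child fun x => K.joint (s ⬝ᵥ x) (t ⬝ᵥ x) (A.child x)]
  simp_rw [K.sum_joint]

theorem sum_composeMarg (hD1 : ∀ c, ∑ s, D c s = 1) (c : Bit) :
    ∑ A, composeMarg D K.marg c A = 1 := by
  simp only [composeMarg]
  rw [sum_comm, ← hD1 c]
  refine sum_congr rfl fun s _ => ?_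
  rw [← mul_sum, sum_prod_child fun x => K.marg (s ⬝ᵥ x)]
  simp [K.sum_marg]

/-- The answers of the children reveal all the parities of the secret. Sums over secrets for a fixed
table thus collapse to one term. -/
theorem secret_unique {s t : Str n} {A : Table n (h + 1)}
    (hs : ∀ x, K.marg (s ⬝ᵥ x) (A.child x) ≠ 0) (ht : ∀ x, K.marg (t ⬝ᵥ x) (A.child x) ≠ 0) :
    s = t := by
  apply dotProduct_eq
  intro x
  exact Option.some_injective _ ((K.eq_some_of_marg_ne_zero _ _ (hs x)).symm.trans
    (K.eq_some_of_marg_ne_zero _ _ (ht x)))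

theorem composeMarg_eq {s : Str n} {A : Table n (h + 1)}
    (hs : ∀ x, K.marg (s ⬝ᵥ x) (A.child x) ≠ 0) (c : Bit) :
    composeMarg D K.marg c A = D c s * ∏ x, K.marg (s ⬝ᵥ x) (A.child x) := by
  refine sum_eq_single s (fun t _ hts => ?_) (by simp)
  by_contra hne
  exact hts (secret_unique K (fun x =>
    prod_ne_zero_iff.1 (right_ne_zero_of_mul hne) x (mem_univ x)) hs)

theorem rfs_eq_some_of_composeMarg_ne_zero (hg : ∀ c s, D c s ≠ 0 → g s = some c) {c : Bit}
    {A : Table n (h + 1)} (hne : composeMarg D K.marg c A ≠ 0) : rfs g (h + 1) A = some c := by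
  obtain ⟨s, -, hs⟩ := exists_ne_zero_of_sum_ne_zero hne
  rw [rfs_succ_eq_some_iff]
  exact ⟨s, fun x => K.eq_some_of_marg_ne_zero _ _
    (prod_ne_zero_iff.1 (right_ne_zero_of_mul hs) x (mem_univ x)), hg c s (left_ne_zero_of_mul hs)⟩

theorem flipMass_composeJoint (c d : Bit) (A : Table n (h + 1)) (z : Fin (h + 1) → Str n) :
    flipMass (composeJoint D K.joint c d) A z =
      ∑ s, ∑ t, secretJoint D c d s t *
        (flipMass (K.joint (s ⬝ᵥ z 0) (t ⬝ᵥ z 0)) (A.child (z 0)) (Fin.tail z) *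
          ∏ x ∈ univ.erase (z 0), K.marg (s ⬝ᵥ x) (A.child x)) := by
  have key : ∀ s t : Str n,
      ∑ B : Table n (h + 1), (if A z ≠ B z then
        ∏ x, K.joint (s ⬝ᵥ x) (t ⬝ᵥ x) (A.child x) (B.child x) else 0) =
      flipMass (K.joint (s ⬝ᵥ z 0) (t ⬝ᵥ z 0)) (A.child (z 0)) (Fin.tail z) *
          ∏ x ∈ univ.erase (z 0), K.marg (s ⬝ᵥ x) (A.child x) := by
    intro s t
    -- The condition that the tables differ at `z` concerns only the child `z 0`, so it can be
    -- absorbed into that factor; the other factors sum to marginals.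
    set F : Str n → Table n h → ℝ := fun x a =>
      if x = z 0 ∧ A.child x (Fin.tail z) = a (Fin.tail z) then 0
      else K.joint (s ⬝ᵥ x) (t ⬝ᵥ x) (A.child x) a with hF
    have h1 : ∀ B : Table n (h + 1), (if A z ≠ B z then
        ∏ x, K.joint (s ⬝ᵥ x) (t ⬝ᵥ x) (A.child x) (B.child x) else 0) =
        ∏ x, F x (B.child x) := by
      intro B
      rw [A.apply_eq_child, B.apply_eq_child]
      split_ifs with hz
      · refine prod_congr rfl fun x _ => ?_
        rw [hF]
        refine (if_neg ?_).symm
        rintro ⟨rfl, hx⟩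
        exact hz hx
      · refine (prod_eq_zero (mem_univ (z 0)) ?_).symm
        exact if_pos ⟨rfl, not_not.1 hz⟩
    simp_rw [h1]
    rw [sum_prod_child, ← mul_prod_erase univ _ (mem_univ (z 0))]
    congr 1
    · refine sum_congr rfl fun a _ => ?_
      simp only [hF, true_and, ne_eq, ite_not]
    · refine prod_congr rfl fun x hx => ?_
      simp only [hF, ne_of_mem_erase hx, false_and, if_false, K.sum_joint]
  simp only [← key]
  simp only [flipMass, composeJoint, mul_sum]
  calc _ = ∑ B : Table n (h + 1), ∑ s : Str n, ∑ t : Str n, secretJoint D c d s t *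
        (if A z ≠ B z then
          ∏ x, K.joint (s ⬝ᵥ x) (t ⬝ᵥ x) (A.child x) (B.child x) else 0) := by
        refine sum_congr rfl fun B _ => ?_
        split_ifs <;> simp
    _ = _ := by
        rw [sum_comm]
        exact sum_congr rfl fun s _ => sum_comm

/-- The table `A` determines its secret `s`, while the partner's secret `t'` is independent. If `t'`
agrees with `s` at `z 0`, the child coupling is diagonal and has no flips; otherwise the partner's
bit is forced, so all such `t'` give the same child flip mass. -/
theorem flipMass_composeJoint_eq {c d : Bit} (hcd : c ≠ d) {s t : Str n} {A : Table n (h + 1)}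
    (hs : ∀ x, K.marg (s ⬝ᵥ x) (A.child x) ≠ 0) {z : Fin (h + 1) → Str n}
    (hst : s ⬝ᵥ z 0 ≠ t ⬝ᵥ z 0) :
    flipMass (composeJoint D K.joint c d) A z =
      (D c s * ∏ x ∈ univ.erase (z 0), K.marg (s ⬝ᵥ x) (A.child x)) *
        flipMass (K.joint (s ⬝ᵥ z 0) (t ⬝ᵥ z 0)) (A.child (z 0)) (Fin.tail z) *
          ∑ t', if t' ⬝ᵥ z 0 = s ⬝ᵥ z 0 then 0 else D d t' := by
  have hbit : ∀ a b e : Bit, a ≠ b → e ≠ a → e = b := by decide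
  rw [flipMass_composeJoint, sum_eq_single s, mul_sum]
  · refine sum_congr rfl fun t' _ => ?_
    rw [secretJoint, if_neg hcd]
    split_ifs with ht'
    · rw [ht', K.flipMass_self]
      ring
    · rw [hbit _ _ _ hst ht']
      ring
  · intro s' _ hs'
    refine sum_eq_zero fun t' _ => ?_
    by_contra hne
    -- A nonzero term would make `s'` compatible with every child of `A`: at `z 0` through the
    -- positive flip mass, elsewhere through the product.
    have h1 := right_ne_zero_of_mul hne
    have h2 := prod_ne_zero_iff.1 (right_ne_zero_of_mul h1)
    refine hs' (secret_unique K (fun x => ?_) hs)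
    by_cases hx : x = z 0
    · have h3 := lt_of_le_of_ne (flipMass_nonneg (K.joint_nonneg _ _) _ _)
        (left_ne_zero_of_mul h1).symm
      rw [hx]
      exact (h3.trans_le (K.flipMass_le_marg _ _ _ _)).ne'
    · exact h2 x (mem_erase.2 ⟨hx, mem_univ x⟩)
  · simp

theorem flipMass_mul_composeJoint_le {ε : ℝ} (hD : ∀ c s, 0 ≤ D c s) (hv : 0 ≤ v)
    (hg : ∀ c s, D c s ≠ 0 → g s = some c)
    (hε : ∀ c d, c ≠ d → ∀ s t z : Str n, g s = some c → g t = some d →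
      (∑ t', if t' ⬝ᵥ z = s ⬝ᵥ z then 0 else D d t') *
        (∑ s', if s' ⬝ᵥ z = t ⬝ᵥ z then 0 else D c s') ≤ ε)
    {c d : Bit} {A B : Table n (h + 1)} {z : Fin (h + 1) → Str n}
    (hne : composeJoint D K.joint c d A B ≠ 0) (hz : A z ≠ B z) :
    flipMass (composeJoint D K.joint c d) A z * flipMass (composeJoint D K.joint d c) B z ≤
      v * ε * (composeMarg D K.marg c A * composeMarg D K.marg d B) := by
  obtain ⟨s, t, hJ, hK⟩ := exists_of_composeJoint_ne_zero K hne
  have hA : ∀ x, K.marg (s ⬝ᵥ x) (A.child x) ≠ 0 := fun x => K.marg_ne_zero (hK x)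
  have hB : ∀ x, K.marg (t ⬝ᵥ x) (B.child x) ≠ 0 := fun x =>
    K.marg_ne_zero (K.joint_comm _ _ _ _ ▸ hK x)
  rw [A.apply_eq_child, B.apply_eq_child] at hz
  -- Equal bits at `z 0` would couple the two subtables diagonally, contradicting their difference.
  have hst : s ⬝ᵥ z 0 ≠ t ⬝ᵥ z 0 := by
    intro heq
    have h1 := hK (z 0)
    rw [heq] at h1
    exact hz (congrFun (K.eq_of_joint_ne_zero _ _ _ h1) _)
  have hcd : c ≠ d := by
    rintro rfl
    refine hst ?_
    by_contra h1
    refine hJ ?_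
    rw [secretJoint, if_pos rfl, if_neg]
    rintro rfl
    exact h1 rfl
  rw [secretJoint, if_neg hcd] at hJ
  rw [flipMass_composeJoint_eq K hcd hA hst, flipMass_composeJoint_eq K hcd.symm hB hst.symm,
    composeMarg_eq K hA, composeMarg_eq K hB, ← mul_prod_erase univ _ (mem_univ (z 0)),
    ← mul_prod_erase univ (fun x => K.marg (t ⬝ᵥ x) (B.child x)) (mem_univ (z 0))]
  have hflip := K.flipMass_mul_le _ _ _ _ (Fin.tail z) (hK (z 0)) hz
  have hprob := hε c d hcd s t (z 0) (hg _ _ (left_ne_zero_of_mul hJ))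
    (hg _ _ (right_ne_zero_of_mul hJ))
  have hw : 0 ≤ (D c s * ∏ x ∈ univ.erase (z 0), K.marg (s ⬝ᵥ x) (A.child x)) *
      (D d t * ∏ x ∈ univ.erase (z 0), K.marg (t ⬝ᵥ x) (B.child x)) :=
    mul_nonneg (mul_nonneg (hD _ _) (prod_nonneg fun _ _ => K.marg_nonneg _ _))
      (mul_nonneg (hD _ _) (prod_nonneg fun _ _ => K.marg_nonneg _ _))
  have hprob0 : 0 ≤ (∑ t', if t' ⬝ᵥ z 0 = s ⬝ᵥ z 0 then 0 else D d t') *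
      (∑ s', if s' ⬝ᵥ z 0 = t ⬝ᵥ z 0 then 0 else D c s') :=
    mul_nonneg (sum_nonneg fun _ _ => by split_ifs <;> simp [hD])
      (sum_nonneg fun _ _ => by split_ifs <;> simp [hD])
  have hmul := mul_le_mul_of_nonneg_left (mul_le_mul hflip hprob hprob0
    (mul_nonneg hv (mul_nonneg (K.marg_nonneg _ _) (K.marg_nonneg _ _)))) hw
  linarith

/-- The weighted adversary for one more level of recursion. -/
noncomputable def WeightedAdversary.compose {ε : ℝ} (hD : ∀ c s, 0 ≤ D c s)
    (hD1 : ∀ c, ∑ s, D c s = 1) (hv : 0 ≤ v) (hg : ∀ c s, D c s ≠ 0 → g s = some c)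
    (hε : ∀ c d, c ≠ d → ∀ s t z : Str n, g s = some c → g t = some d →
      (∑ t', if t' ⬝ᵥ z = s ⬝ᵥ z then 0 else D d t') *
        (∑ s', if s' ⬝ᵥ z = t ⬝ᵥ z then 0 else D c s') ≤ ε) :
    WeightedAdversary (rfs g (h + 1)) (v * ε) where
  marg := composeMarg D K.marg
  joint := composeJoint D K.joint
  joint_nonneg c d A B := sum_nonneg fun s _ => sum_nonneg fun t _ =>
    mul_nonneg (secretJoint_nonneg hD c d s t) (prod_nonneg fun x _ => K.joint_nonneg _ _ _ _)
  joint_comm c d A B := by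
    rw [composeJoint, sum_comm, composeJoint]
    refine sum_congr rfl fun t _ => sum_congr rfl fun s _ => ?_
    rw [secretJoint_comm]
    congr 1
    exact prod_congr rfl fun x _ => K.joint_comm _ _ _ _
  sum_joint := sum_composeJoint K hD1
  sum_marg := sum_composeMarg K hD1
  eq_of_joint_ne_zero c A B hne := by
    obtain ⟨s, t, hJ, hK⟩ := exists_of_composeJoint_ne_zero K hne
    have hst : s = t := by
      by_contra hst
      exact hJ (by rw [secretJoint, if_pos rfl, if_neg hst])
    subst hst
    exact (Table.childEquiv n h).injective (funext fun x => K.eq_of_joint_ne_zero _ _ _ (hK x))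
  eq_some_of_marg_ne_zero _ _ := rfs_eq_some_of_composeMarg_ne_zero K hg
  flipMass_mul_le _ _ _ _ _ := flipMass_mul_composeJoint_le K hD hv hg hε

end Compose

/-- The weighted adversary for the function that returns its only input bit. -/
noncomputable def WeightedAdversary.zero {n : ℕ} (g : PartialBool n) :
    WeightedAdversary (rfs g 0) 1 := by
  have hsum : ∀ c : Bit, ∑ A : Table n 0, (if A Fin.elim0 = c then (1 : ℝ) else 0) = 1 := by
    intro c
    rw [sum_eq_single fun _ => c]
    · simp
    · intro A _ hA
      rw [if_neg]
      rintro rfl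
      exact hA (funext fun y => congrArg A (Subsingleton.elim _ _))
    · simp
  have hjoint : ∀ (c d : Bit) (A : Table n 0), ∑ B : Table n 0,
      (if A Fin.elim0 = c then (1 : ℝ) else 0) * (if B Fin.elim0 = d then 1 else 0) =
        if A Fin.elim0 = c then 1 else 0 := by
    intro c d A
    rw [← mul_sum, hsum, mul_one]
  have hnonneg : ∀ (c d : Bit) (A B : Table n 0), (0 : ℝ) ≤
      (if A Fin.elim0 = c then (1 : ℝ) else 0) * (if B Fin.elim0 = d then 1 else 0) := by
    intro c d A B
    positivity
  exact
    -- Each marginal is a point mass, so the product coupling is already diagonal when `c = d`.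
    { marg := fun c A => if A Fin.elim0 = c then 1 else 0
      joint := fun c d A B => (if A Fin.elim0 = c then 1 else 0) * (if B Fin.elim0 = d then 1 else 0)
      joint_nonneg := hnonneg
      joint_comm := fun c d A B => mul_comm _ _
      sum_joint := hjoint
      sum_marg := hsum
      eq_of_joint_ne_zero := by
        intro c A B hne
        simp only [ne_eq, mul_eq_zero, ite_eq_right_iff, one_ne_zero, imp_false, not_or,
          not_not] at hne
        funext y
        rw [Subsingleton.elim y Fin.elim0, hne.1, hne.2]
      eq_some_of_marg_ne_zero := by
        intro c A hne
        simp only [ne_eq, ite_eq_right_iff, one_ne_zero, imp_false, not_not] at hne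
        rw [rfs, hne]
      flipMass_mul_le := by
        intro c d A B i _ _
        rw [one_mul]
        refine mul_le_mul ?_ ?_ (flipMass_nonneg (hnonneg d c) _ _) (by positivity)
        · exact (flipMass_le_sum (hnonneg c d) A i).trans (hjoint c d A).le
        · exact (flipMass_le_sum (hnonneg d c) B i).trans (hjoint d c B).le }

theorem nonempty_weightedAdversary {n : ℕ} {g : PartialBool n} {D : Bit → Str n → ℝ} {ε : ℝ}
    (hε0 : 0 ≤ ε) (hD : ∀ c s, 0 ≤ D c s)
    (hD1 : ∀ c, ∑ s, D c s = 1) (hg : ∀ c s, D c s ≠ 0 → g s = some c)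
    (hε : ∀ c d, c ≠ d → ∀ s t z : Str n, g s = some c → g t = some d →
      (∑ t', if t' ⬝ᵥ z = s ⬝ᵥ z then 0 else D d t') *
        (∑ s', if s' ⬝ᵥ z = t ⬝ᵥ z then 0 else D c s') ≤ ε) (h : ℕ) :
    Nonempty (WeightedAdversary (rfs g h) (ε ^ h)) := by
  induction h with
  | zero =>
    rw [pow_zero]
    exact ⟨.zero g⟩
  | succ h ih =>
    obtain ⟨K⟩ := ih
    rw [pow_succ]
    exact ⟨K.compose hD hD1 (pow_nonneg hε0 h) hg hε⟩

/-! ### The nonparity coefficient -/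

/-- The complementary event is that both parities disagree; by independence its probability is the
product. -/
theorem agreeProb_add_mul {n : ℕ} {D₀ D₁ : Str n → ℝ} (h₀ : ∑ s, D₀ s = 1) (h₁ : ∑ s, D₁ s = 1)
    (z t₀ t₁ : Str n) :
    agreeProb D₀ D₁ z t₀ t₁ + (∑ s₀, if s₀ ⬝ᵥ z = t₁ ⬝ᵥ z then 0 else D₀ s₀) *
      (∑ s₁, if s₁ ⬝ᵥ z = t₀ ⬝ᵥ z then 0 else D₁ s₁) = 1 := by
  have h2 : ∑ s₀, ∑ s₁, D₀ s₀ * D₁ s₁ = 1 := by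
    rw [← sum_mul_sum, h₀, h₁, mul_one]
  rw [agreeProb, sum_mul_sum, ← sum_add_distrib, ← h2]
  refine sum_congr rfl fun s₀ _ => ?_
  rw [← sum_add_distrib]
  refine sum_congr rfl fun s₁ _ => ?_
  by_cases ha : s₀ ⬝ᵥ z = t₁ ⬝ᵥ z <;> by_cases hb : s₁ ⬝ᵥ z = t₀ ⬝ᵥ z <;> simp [ha, hb]

theorem agreeProb_nonneg {n : ℕ} {D₀ D₁ : Str n → ℝ} (h₀ : ∀ s, 0 ≤ D₀ s) (h₁ : ∀ s, 0 ≤ D₁ s)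
    (z t₀ t₁ : Str n) : 0 ≤ agreeProb D₀ D₁ z t₀ t₁ :=
  sum_nonneg fun _ _ => sum_nonneg fun _ _ => by
    split_ifs
    · exact mul_nonneg (h₀ _) (h₁ _)
    · exact le_rfl

theorem agreeProb_le_one {n : ℕ} {g : PartialBool n} {D₀ D₁ : Str n → ℝ} (h₀ : IsDistOver g 0 D₀)
    (h₁ : IsDistOver g 1 D₁) (z t₀ t₁ : Str n) : agreeProb D₀ D₁ z t₀ t₁ ≤ 1 := by
  rw [← agreeProb_add_mul h₀.1.2 h₁.1.2 z t₀ t₁]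
  refine le_add_of_nonneg_right (mul_nonneg (sum_nonneg fun s _ => ?_) (sum_nonneg fun s _ => ?_))
  · split_ifs <;> simp [h₀.1.1 s]
  · split_ifs <;> simp [h₁.1.1 s]

theorem isDistOver_single {n : ℕ} {g : PartialBool n} {b : Bit} {s : Str n} (hs : g s = some b) :
    IsDistOver g b (Pi.single s 1) := by
  refine ⟨single_mem_stdSimplex ℝ s, fun t ht => ?_⟩
  by_cases h : t = s
  · rw [h, hs]
  · simp [h] at ht

section Nonparity

variable {n : ℕ} {g : PartialBool n}

/-- The agreement probabilities that can be guaranteed. -/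
def guaranteed (g : PartialBool n) : Set ℝ :=
  {r : ℝ | ∃ D₀ D₁ : Str n → ℝ, IsDistOver g 0 D₀ ∧ IsDistOver g 1 D₁ ∧
    ∀ z t₀ t₁ : Str n, g t₀ = some 0 → g t₁ = some 1 → r ≤ agreeProb D₀ D₁ z t₀ t₁}

theorem guaranteed_nonempty (h₀ : ∃ s, g s = some 0) (h₁ : ∃ s, g s = some 1) :
    (guaranteed g).Nonempty := by
  obtain ⟨s₀, hs₀⟩ := h₀
  obtain ⟨s₁, hs₁⟩ := h₁
  exact ⟨0, _, _, isDistOver_single hs₀, isDistOver_single hs₁, fun z t₀ t₁ _ _ =>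
    agreeProb_nonneg (isDistOver_single hs₀).1.1 (isDistOver_single hs₁).1.1 z t₀ t₁⟩

theorem le_one_of_mem_guaranteed (h₀ : ∃ s, g s = some 0) (h₁ : ∃ s, g s = some 1) {r : ℝ}
    (hr : r ∈ guaranteed g) : r ≤ 1 := by
  obtain ⟨s₀, hs₀⟩ := h₀
  obtain ⟨s₁, hs₁⟩ := h₁
  obtain ⟨D₀, D₁, hD₀, hD₁, h⟩ := hr
  exact (h 0 s₀ s₁ hs₀ hs₁).trans (agreeProb_le_one hD₀ hD₁ _ _ _)

theorem nonparityCoeff_le_one (h₀ : ∃ s, g s = some 0) (h₁ : ∃ s, g s = some 1) :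
    nonparityCoeff g ≤ 1 :=
  csSup_le (guaranteed_nonempty h₀ h₁) fun _ => le_one_of_mem_guaranteed h₀ h₁

theorem nonempty_weightedAdversary_of_lt (h₀ : ∃ s, g s = some 0) (h₁ : ∃ s, g s = some 1)
    {ε : ℝ} (hε : 1 - nonparityCoeff g < ε) (h : ℕ) :
    Nonempty (WeightedAdversary (rfs g h) (ε ^ h)) := by
  obtain ⟨r, ⟨D₀, D₁, hD₀, hD₁, hr⟩, hlt⟩ :=
    exists_lt_of_lt_csSup (guaranteed_nonempty h₀ h₁) (show 1 - ε < nonparityCoeff g by linarith)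
  have hbit : ∀ c : Bit, c = 0 ∨ c = 1 := by decide
  have hpair : ∀ c d : Bit, c ≠ d → c = 0 ∧ d = 1 ∨ c = 1 ∧ d = 0 := by decide
  have hprod : ∀ z t₀ t₁ : Str n, g t₀ = some 0 → g t₁ = some 1 →
      (∑ s₀, if s₀ ⬝ᵥ z = t₁ ⬝ᵥ z then 0 else D₀ s₀) *
        (∑ s₁, if s₁ ⬝ᵥ z = t₀ ⬝ᵥ z then 0 else D₁ s₁) ≤ ε := by
    intro z t₀ t₁ ht₀ ht₁
    have h2 := agreeProb_add_mul hD₀.1.2 hD₁.1.2 z t₀ t₁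
    have h3 := hr z t₀ t₁ ht₀ ht₁
    linarith
  refine nonempty_weightedAdversary (D := fun c => if c = 0 then D₀ else D₁)
    (by linarith [nonparityCoeff_le_one h₀ h₁]) ?_ ?_ ?_ ?_ h
  · intro c s
    obtain rfl | rfl := hbit c
    · simpa using hD₀.1.1 s
    · simpa using hD₁.1.1 s
  · intro c
    obtain rfl | rfl := hbit c
    · simpa using hD₀.1.2
    · simpa using hD₁.1.2
  · intro c s
    obtain rfl | rfl := hbit c
    · simpa using hD₀.2 s
    · simpa using hD₁.2 s
  · intro c d hcd s t z hs ht
    obtain ⟨rfl, rfl⟩ | ⟨rfl, rfl⟩ := hpair c d hcd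
    · rw [mul_comm]
      simpa using hprod z s t hs ht
    · simpa using hprod z t s ht hs

theorem sq_le_queries_sq_mul (h₀ : ∃ s, g s = some 0) (h₁ : ∃ s, g s = some 1) {h m : ℕ}
    {alg : QueryAlgorithm (Fin h → Str n) m} (halg : alg.Computes (rfs g h)) :
    (1 / 36 : ℝ) ^ 2 ≤ (alg.queries : ℝ) ^ 2 * (1 - nonparityCoeff g) ^ h := by
  have hμ := nonparityCoeff_le_one h₀ h₁
  have hbound : ∀ ε, 1 - nonparityCoeff g < ε →
      (1 / 36 : ℝ) ^ 2 ≤ (alg.queries : ℝ) ^ 2 * ε ^ h := by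
    intro ε hε
    have hε0 : 0 < ε := by linarith
    obtain ⟨K⟩ := nonempty_weightedAdversary_of_lt h₀ h₁ hε h
    have h2 := K.le_queries_mul halg (Real.sqrt_pos.2 (pow_pos hε0 h))
      (Real.sq_sqrt (pow_nonneg hε0.le h)).ge
    have h3 := pow_le_pow_left₀ (by norm_num) h2 2
    rwa [mul_pow, Real.sq_sqrt (pow_nonneg hε0.le h)] at h3
  have hcont : Continuous fun ε : ℝ => (alg.queries : ℝ) ^ 2 * ε ^ h := by fun_prop
  -- The limit from above removes the slack in `ε`, so the supremum need not be shown to be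
  -- attained.
  exact ge_of_tendsto (hcont.continuousWithinAt (s := Set.Ioi (1 - nonparityCoeff g)))
    (eventually_mem_nhdsWithin.mono hbound)

end Nonparity

/-! ### From the squared inequality to the stated bound. -/

theorem mul_rpow_neg_half_le {c x T : ℝ} {h : ℕ} (hc : 0 < c) (hx : 0 ≤ x) (hT : 0 ≤ T)
    (hle : c ^ 2 ≤ T ^ 2 * x ^ h) : c * x ^ (-(h : ℝ) / 2) ≤ T := by
  -- The inequality itself excludes `x ^ h = 0`, so `nonparityCoeff g < 1` is not needed separately.
  have hpos : 0 < x ^ h := by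
    refine lt_of_le_of_ne (pow_nonneg hx h) fun h0 => ?_
    rw [← h0, mul_zero] at hle
    exact absurd hle (not_le.2 (pow_pos hc 2))
  have hxp : x ^ (-(h : ℝ) / 2) = (Real.sqrt (x ^ h))⁻¹ := by
    rw [neg_div, Real.rpow_neg hx, Real.sqrt_eq_rpow, ← Real.rpow_natCast, ← Real.rpow_mul hx,
      mul_one_div]
  rw [hxp, ← div_eq_mul_inv, div_le_iff₀ (Real.sqrt_pos.2 hpos)]
  refine le_of_sq_le_sq ?_ (by positivity)
  rwa [mul_pow, Real.sq_sqrt hpos.le]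

end RFS

theorem theorem3 :
    ∃ c : ℝ, 0 < c ∧
      ∀ (n : ℕ) (g : RFS.PartialBool n), (∃ s, g s = some 0) → (∃ s, g s = some 1) →
        ∀ h : ℕ,
          ENNReal.ofReal (c * (1 - RFS.nonparityCoeff g) ^ (-(h : ℝ) / 2)) ≤
            ((RFS.Q₂ (RFS.rfs g h) : ℕ∞) : ENNReal) := by
  refine ⟨1 / 36, by norm_num, fun n g h₀ h₁ h => ?_⟩
  -- Rounding up gives a natural number below every query count, hence below the infimum in `ℕ∞`.
  have hle : ((⌈1 / 36 * (1 - RFS.nonparityCoeff g) ^ (-(h : ℝ) / 2)⌉₊ : ℕ) : ℕ∞) ≤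
      RFS.Q₂ (RFS.rfs g h) := by
    refine le_iInf fun m => le_iInf fun alg => le_iInf fun halg => Nat.cast_le.2 ?_
    exact Nat.ceil_le.2 (RFS.mul_rpow_neg_half_le (by norm_num)
      (sub_nonneg.2 (RFS.nonparityCoeff_le_one h₀ h₁)) (Nat.cast_nonneg _)
      (RFS.sq_le_queries_sq_mul h₀ h₁ halg))
  refine le_trans ?_ (ENat.toENNReal_le.2 hle)
  rw [ENat.toENNReal_coe, ← ENNReal.ofReal_natCast]
  exact ENNReal.ofReal_le_ofReal (Nat.le_ceil _)
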